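/- Let $M$ be a closed (compact, without boundary) connected Riemannian manifold of dimension $n$, let $\rho$ be a representation of $\pi_1(M)$ by linear isometries on a real inner product space $V$, and let $E(\rho)=\widetilde M\times_\rho V$ be the associated flat bundle. For $0\le k\le n$ let $\Omega^k$ be the space of smooth $E(\rho)$-valued $k$-forms with its $L^2$ inner product $\langle\,,\rangle$, let $d_k:\Omega^k\to\Omega^{k+1}$ be the exterior differential coupled to the flat connection, and let $\Omega'_k=\operatorname{Im} d_{k-1}\subset\Omega^k$ be the exact part ($\Omega_0'=0$). Assume that the complex $(\Omega^\bullet,d_\bullet)$ is acyclic. Let $\mathcal H_k$ be the $L^2$ completion of $\Omega^k$, let $\mathcal H'_k$ be the closure of $\Omega'_k$ in $\mathcal H_k$, and let $\xi\mapsto\xi'$ be the orthogonal projection $\mathcal H_k\to\mathcal H_k'$. Gaussian measures are carried by Hilbert–Schmidt extensions. A Hilbert–Schmidt extension of a Hilbert space $\mathcal H$ is a Hilbert space $K$ with an injective Hilbert–Schmidt operator $J:\mathcal H\to K$ of dense range. The test vectors are the $\xi=J^*y\in\mathcal H$ with $y\in K$; they are paired with $\varphi\in K$ by $\langle\xi,\varphi\rangle:=\langle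 y,\varphi\rangle_K$. The Gaussian measure with characteristic function $\exp(-\frac c2\langle\xi,\xi\rangle)$ is the Borel probability measure $\mu$ on $K$ with $\widehat\mu(\xi):=\int_K e^{i\langle\xi,\varphi\rangle}\,d\mu(\varphi)=\exp(-\frac c2\langle\xi,\xi\rangle_{\mathcal H})$ for all test vectors $\xi$. Let $K$ and $K'$ be Hilbert–Schmidt extensions of $\mathcal H_k$ and $\mathcal H_k'$ such that the projection $\xi\mapsto\xi'$ extends to a continuous linear map $K\to K'$, written $\alpha\mapsto\alpha'$. Let $a,b>0$, let $\mu_a$ be the Gaussian measure on $K$ with characteristic function $\exp(-\frac a2\langle\alpha,\alpha\rangle)$, and let $\mu'_b$ be the Gaussian measure on $K'$ with characteristic function $\exp(-\frac b2\langle\eta,\eta\rangle)$. Write $\widehat\mu'_a$ for the restriction of $\widehat\mu_a$ to the test vectors of $\mathcal H'_k$, that is, $\widehat\mu_a'(\xi)=\int_K e^{i\langle\xi,\alpha'\rangle}\,d\mu_a(\alpha)$. For a finite-dimensional space $S$ of test vectors of $\mathcal H_k'$ and $\eta\in K'$, let $P_S\eta\in S$ be the vector with $\langle\xi,P_S\eta\rangle_{\mathcal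 H'_k}=\langle\xi,\eta\rangle$ for all $\xi\in S$. Then: 1. For every such $S$, $$\int_{K'}\widehat\mu'_a(P_S\eta)\,d\mu'_b(\eta)=\int_{K}\widehat\mu'_b(P_S\alpha')\,d\mu_a(\alpha),$$ both integrands being integrable. 2. For every $\eta\in K'$ the limits $\widehat\mu'_a(\eta):=\lim_S\widehat\mu'_a(P_S\eta)$ and $\widehat\mu'_b(\eta):=\lim_S\widehat\mu'_b(P_S\eta)$ exist, along the finite-dimensional spaces $S$ of test vectors of $\mathcal H_k'$ directed by inclusion. With these extensions of the characteristic functions to $K'$, the functions $\eta\mapsto\widehat\mu_a'(\eta)$ and $\alpha\mapsto\widehat\mu_b'(\alpha')$ are integrable with respect to $\mu'_b$ and $\mu_a$, and $$\int_{K'}\widehat\mu'_a(\eta)\,d\mu'_b(\eta)=\int_{K}\widehat\mu'_b(\alpha')\,d\mu_a(\alpha).$$ -/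

import Mathlib

open Set Filter Topology MeasureTheory Bundle Manifold
open scoped ContDiff Bundle Manifold ENNReal

set_option linter.unusedSectionVars false

noncomputable section

namespace TwistedForms

section Pointwise

variable {T V : Type*} [NormedAddCommGroup T] [InnerProductSpace ℝ T] [FiniteDimensional ℝ T]
  [NormedAddCommGroup V] [InnerProductSpace ℝ V] {k : ℕ}

/-- The inner product on `Λᵏ T* ⊗ V` induced by the inner products of `T` and `V`. With `e` an
orthonormal basis of `T`, it is `∑_{i₁ < ⋯ < iₖ} ⟪A(e_{i₁},…,e_{iₖ}), B(e_{i₁},…,e_{iₖ})⟫`,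
written here as `1/k!` times the sum over all multi-indices. -/
def altInner (A B : T [⋀^Fin k]→L[ℝ] V) : ℝ :=
  ((k.factorial : ℝ))⁻¹ * ∑ i : Fin k → Fin (Module.finrank ℝ T),
    inner ℝ (A fun l => stdOrthonormalBasis ℝ T (i l)) (B fun l => stdOrthonormalBasis ℝ T (i l))

/-- The same inner product in an arbitrary basis, through the inverse Gram matrix. -/
theorem altInner_eq_gram {ι : Type*} [Fintype ι] [DecidableEq ι] (f : Module.Basis ι ℝ T)
    (A B : T [⋀^Fin k]→L[ℝ] V) :
    altInner A B = ((k.factorial : ℝ))⁻¹ * ∑ p : Fin k → ι, ∑ q : Fin k → ι,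
      (∏ l, (Matrix.of fun i j => inner ℝ (f i) (f j))⁻¹ (p l) (q l)) *
        inner ℝ (A fun l => f (p l)) (B fun l => f (q l)) := by
  set e := stdOrthonormalBasis ℝ T with he
  set C : Matrix (Fin (Module.finrank ℝ T)) ι ℝ := Matrix.of fun i p => f.repr (e i) p with hC
  set D : Matrix ι (Fin (Module.finrank ℝ T)) ℝ := Matrix.of fun p j => inner ℝ (e j) (f p) with hD
  have hCD : C * D = 1 := by
    ext i j
    have h1 : inner ℝ (e j) (e i) = ∑ p, f.repr (e i) p * inner ℝ (e j) (f p) := by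
      conv_lhs => rw [← f.sum_repr (e i)]
      rw [inner_sum]
      simp [inner_smul_right]
    rw [Matrix.mul_apply]
    simp only [hC, hD, Matrix.of_apply]
    rw [← h1, e.inner_eq_ite, Matrix.one_apply]
    simp [eq_comm]
  have hDC : D * C = 1 := by
    ext p q
    have h1 : f.repr (f p) q = ∑ j, inner ℝ (e j) (f p) * f.repr (e j) q := by
      conv_lhs => rw [← e.sum_repr' (f p)]
      simp
    rw [Matrix.mul_apply]
    simp only [hC, hD, Matrix.of_apply]
    rw [← h1, f.repr_self, Matrix.one_apply, Finsupp.single_apply]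
  have hG : (Matrix.of fun i j => inner ℝ (f i) (f j)) = D * D.transpose := by
    ext p q
    rw [Matrix.mul_apply]
    simp only [hD, Matrix.of_apply, Matrix.transpose_apply]
    rw [← e.sum_inner_mul_inner (f p) (f q)]
    exact Finset.sum_congr rfl fun j _ => by rw [real_inner_comm]
  have hinv : (Matrix.of fun i j => inner ℝ (f i) (f j))⁻¹ = C.transpose * C := by
    apply Matrix.inv_eq_right_inv
    rw [hG, Matrix.mul_assoc, ← Matrix.mul_assoc D.transpose, ← Matrix.transpose_mul, hCD,
      Matrix.transpose_one, Matrix.one_mul, hDC]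
  have hexp : ∀ (A : T [⋀^Fin k]→L[ℝ] V) (i : Fin k → Fin (Module.finrank ℝ T)),
      (A fun l => e (i l)) = ∑ p : Fin k → ι, (∏ l, C (i l) (p l)) • A fun l => f (p l) := by
    intro A i
    have h1 : (fun l => e (i l)) = fun l => ∑ p, C (i l) p • f p := by
      funext l
      exact (f.sum_repr (e (i l))).symm
    rw [h1]
    change A.toMultilinearMap (fun l => ∑ p, C (i l) p • f p) = _
    rw [MultilinearMap.map_sum]
    refine Finset.sum_congr rfl fun p _ => ?_
    rw [MultilinearMap.map_smul_univ]
    rfl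
  rw [altInner, hinv]
  congr 1
  simp only [← he, hexp, sum_inner, inner_sum, real_inner_smul_left, real_inner_smul_right]
  conv_rhs => rw [Finset.sum_comm]
  rw [Finset.sum_comm]
  refine Finset.sum_congr rfl fun q _ => ?_
  rw [Finset.sum_comm]
  refine Finset.sum_congr rfl fun p _ => ?_
  simp only [← mul_assoc, ← Finset.sum_mul]
  congr 1
  simp only [← Finset.prod_mul_distrib, Matrix.mul_apply, Matrix.transpose_apply]
  rw [Finset.prod_univ_sum, Fintype.piFinset_univ]
  exact Finset.sum_congr rfl fun x _ => Finset.prod_congr rfl fun _ _ => mul_comm _ _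

theorem altInner_comm (A B : T [⋀^Fin k]→L[ℝ] V) : altInner A B = altInner B A := by
  simp [altInner, real_inner_comm]

theorem altInner_add_left (A A' B : T [⋀^Fin k]→L[ℝ] V) :
    altInner (A + A') B = altInner A B + altInner A' B := by
  simp [altInner, inner_add_left, Finset.sum_add_distrib, mul_add]

theorem altInner_smul_left (r : ℝ) (A B : T [⋀^Fin k]→L[ℝ] V) :
    altInner (r • A) B = r * altInner A B := by
  simp only [altInner, ContinuousAlternatingMap.smul_apply, real_inner_smul_left,
    ← Finset.mul_sum]
  ring

theorem altInner_self_nonneg (A : T [⋀^Fin k]→L[ℝ] V) : 0 ≤ altInner A A :=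
  mul_nonneg (by positivity) (Finset.sum_nonneg fun _ _ => real_inner_self_nonneg)

end Pointwise

section Manifold

variable {n : ℕ} {M : Type*} [TopologicalSpace M] 
  [ChartedSpace (EuclideanSpace ℝ (Fin n)) M] 
  {V : Type*} [NormedAddCommGroup V] [InnerProductSpace ℝ V] {x₀ : M}

variable (n V) in
/-- Arbitrary (not yet equivariant, not yet smooth) families `α x c` indexed by a point `x` and a
homotopy class `c` of paths from the base point `x₀` to `x`, with values in the alternating
`k`-forms on the tangent space at `x` with values in `V`. The classes `c` are the points of the
universal cover of `M` over `x`. -/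
def RawForm (x₀ : M) (k : ℕ) : Type _ :=
  ∀ x : M, Path.Homotopic.Quotient x₀ x → TangentSpace (𝓡 n) x [⋀^Fin k]→L[ℝ] V

instance (k : ℕ) : AddCommGroup (RawForm n V x₀ k) :=
  inferInstanceAs (AddCommGroup (∀ x : M, Path.Homotopic.Quotient x₀ x →
    TangentSpace (𝓡 n) x [⋀^Fin k]→L[ℝ] V))

instance (k : ℕ) : Module ℝ (RawForm n V x₀ k) :=
  inferInstanceAs (Module ℝ (∀ x : M, Path.Homotopic.Quotient x₀ x →
    TangentSpace (𝓡 n) x [⋀^Fin k]→L[ℝ] V))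

/-- The path in `M` from `x` to `φ⁻¹ u` which is a straight segment in the chart `φ` at `x`. -/
def chartRay (x : M) (u : EuclideanSpace ℝ (Fin n))
    (hu : segment ℝ (extChartAt (𝓡 n) x x) u ⊆ (extChartAt (𝓡 n) x).target) :
    Path x ((extChartAt (𝓡 n) x).symm u) where
  toFun t := (extChartAt (𝓡 n) x).symm (AffineMap.lineMap (extChartAt (𝓡 n) x x) u (t : ℝ))
  continuous_toFun := by
    apply (continuousOn_extChartAt_symm x).comp_continuous
    · exact AffineMap.lineMap_continuous.comp continuous_subtype_val
    · intro t
      apply hu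
      rw [segment_eq_image_lineMap]
      exact ⟨t, t.2, rfl⟩
  source' := by simp
  target' := by simp

open Classical in
/-- The `V`-valued form on a neighbourhood of `φ x` in `ℝⁿ` that represents `α` near `x`, where `φ`
is the chart at `x`: the pull-back of `α` by `φ⁻¹`, read in the flat local trivialization in which
the class `c` of paths to `x` is continued to the class of `c` followed by the chart segment from
`x` to `φ⁻¹ u`. -/
def localRep {k : ℕ} (α : RawForm n V x₀ k) (x : M) (c : Path.Homotopic.Quotient x₀ x)
    (u : EuclideanSpace ℝ (Fin n)) : EuclideanSpace ℝ (Fin n) [⋀^Fin k]→L[ℝ] V :=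
  if hu : segment ℝ (extChartAt (𝓡 n) x x) u ⊆ (extChartAt (𝓡 n) x).target then
    (α _ (c.trans (.mk (chartRay x u hu)))).compContinuousLinearMap
      (mfderiv 𝓘(ℝ, EuclideanSpace ℝ (Fin n)) (𝓡 n) (extChartAt (𝓡 n) x).symm u)
  else 0

/-- The exterior derivative coupled to the flat connection: at `x` it is the ordinary exterior
derivative of the local representative of `α` in the chart at `x` and in the flat local
trivialization around `x`. -/
def extD {k : ℕ} (α : RawForm n V x₀ k) : RawForm n V x₀ (k + 1) := fun x c =>
  (extDeriv (localRep α x c) (extChartAt (𝓡 n) x x)).compContinuousLinearMap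
    (mfderiv (𝓡 n) 𝓘(ℝ, EuclideanSpace ℝ (Fin n)) (extChartAt (𝓡 n) x) x)

theorem localRep_add {k : ℕ} (α β : RawForm n V x₀ k) (x : M) (c) :
    localRep (α + β) x c = localRep α x c + localRep β x c := by
  ext u v
  by_cases hu : segment ℝ (extChartAt (𝓡 n) x x) u ⊆ (extChartAt (𝓡 n) x).target
  · simp only [localRep, hu, dif_pos, Pi.add_apply]; rfl
  · simp only [localRep, dif_neg hu, Pi.add_apply]; simp

theorem localRep_smul {k : ℕ} (r : ℝ) (α : RawForm n V x₀ k) (x : M) (c) :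
    localRep (r • α) x c = r • localRep α x c := by
  ext u v
  by_cases hu : segment ℝ (extChartAt (𝓡 n) x x) u ⊆ (extChartAt (𝓡 n) x).target
  · simp only [localRep, hu, dif_pos, Pi.smul_apply]; rfl
  · simp only [localRep, dif_neg hu, Pi.smul_apply]; simp

variable (n) in
/-- The smooth `k`-forms on `M` with values in the flat bundle `E(ρ) = M̃ ×_ρ V`. A point of the
universal cover `M̃` over `x` is a homotopy class `c` of paths from `x₀` to `x`, on which a loop `γ`
acts by `c ↦ γ · c` (first `γ`, then `c`), and an element of the fibre `E(ρ)_x` is a function `f` of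
`c` with `f (γ · c) = ρ(γ)⁻¹ f c`. The product of the fundamental group in Mathlib is the reversed
concatenation, so that this is compatible with concatenation of loops. As `ρ` acts by isometries,
the inner product of `V` is an inner product on `E(ρ)`. -/
def smoothForms (ρ : FundamentalGroup M x₀ →* (V ≃ₗᵢ[ℝ] V)) (k : ℕ) :
    Submodule ℝ (RawForm n V x₀ k) where
  carrier := {α | (∀ (x : M) (γ : FundamentalGroup M x₀) (c : Path.Homotopic.Quotient x₀ x) v,
      α x (γ.toPath.trans c) v = ρ γ⁻¹ (α x c v)) ∧
    ∀ (x : M) (c : Path.Homotopic.Quotient x₀ x),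
      ContDiffAt ℝ ∞ (localRep α x c) (extChartAt (𝓡 n) x x)}
  zero_mem' := by
    refine ⟨fun x γ c v => by simp [show (0 : RawForm n V x₀ k) x = 0 from rfl], fun x c => ?_⟩
    have : localRep (0 : RawForm n V x₀ k) x c = 0 := by
      simpa using localRep_smul 0 (0 : RawForm n V x₀ k) x c
    rw [this]; exact contDiffAt_const
  add_mem' := by
    rintro α β ⟨h1, h2⟩ ⟨h3, h4⟩
    refine ⟨fun x γ c v => ?_, fun x c => ?_⟩
    · change α x _ v + β x _ v = ρ γ⁻¹ (α x c v + β x c v)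
      rw [h1, h3, map_add]
    · rw [localRep_add]; exact (h2 x c).add (h4 x c)
  smul_mem' := by
    rintro r α ⟨h1, h2⟩
    refine ⟨fun x γ c v => ?_, fun x c => ?_⟩
    · change r • α x _ v = ρ γ⁻¹ (r • α x c v)
      rw [h1, map_smul]
    · rw [localRep_smul]; exact contDiffAt_const.smul (h2 x c)

section Riemannian

variable [RiemannianBundle (fun x : M => TangentSpace (𝓡 n) x)]

instance (x : M) : FiniteDimensional ℝ (TangentSpace (𝓡 n) x) :=
  inferInstanceAs (FiniteDimensional ℝ (EuclideanSpace ℝ (Fin n)))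

/-- The pointwise inner product of two forms at `x`; for forms with values in `E(ρ)` it can be
computed with any class of paths (see `pairing_eq`). -/
def pairing [PathConnectedSpace M] {k : ℕ} (α β : RawForm n V x₀ k) (x : M) : ℝ :=
  altInner (α x (.mk (PathConnectedSpace.somePath x₀ x)))
    (β x (.mk (PathConnectedSpace.somePath x₀ x)))

theorem pairing_eq [PathConnectedSpace M] {ρ : FundamentalGroup M x₀ →* (V ≃ₗᵢ[ℝ] V)} {k : ℕ}
    {α β : RawForm n V x₀ k} (hα : α ∈ smoothForms n ρ k) (hβ : β ∈ smoothForms n ρ k) (x : M)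
    (c : Path.Homotopic.Quotient x₀ x) : pairing α β x = altInner (α x c) (β x c) := by
  set c' : Path.Homotopic.Quotient x₀ x := .mk (PathConnectedSpace.somePath x₀ x) with hc'
  have h : ∃ γ : FundamentalGroup M x₀, γ.toPath.trans c = c' := by
    refine ⟨FundamentalGroup.fromPath (c'.trans c.symm), ?_⟩
    let f : FundamentalGroupoid.mk x₀ ⟶ FundamentalGroupoid.mk x := c
    let g : FundamentalGroupoid.mk x₀ ⟶ FundamentalGroupoid.mk x := c'
    have h1 : (CategoryTheory.CategoryStruct.comp
        (CategoryTheory.CategoryStruct.comp g (CategoryTheory.Groupoid.inv f)) f) = g := by simp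
    exact h1
  obtain ⟨γ, hγ⟩ := h
  rw [pairing, ← hc', ← hγ]
  simp only [altInner]
  congr 1
  refine Finset.sum_congr rfl fun i _ => ?_
  rw [hα.1, hβ.1, LinearIsometryEquiv.inner_map_map]

/-- The matrix `g_{ij}` of the Riemannian metric at the point with coordinates `u` in the chart
at `x`. -/
def gram (x : M) (u : EuclideanSpace ℝ (Fin n)) : Matrix (Fin n) (Fin n) ℝ :=
  Matrix.of fun i j => inner ℝ
    (mfderiv 𝓘(ℝ, EuclideanSpace ℝ (Fin n)) (𝓡 n) (extChartAt (𝓡 n) x).symm u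
      (EuclideanSpace.single i 1))
    (mfderiv 𝓘(ℝ, EuclideanSpace ℝ (Fin n)) (𝓡 n) (extChartAt (𝓡 n) x).symm u
      (EuclideanSpace.single j 1))

variable [IsManifold (𝓡 n) ∞ M]
  [IsContMDiffRiemannianBundle (𝓡 n) ∞ (EuclideanSpace ℝ (Fin n))
    (fun x : M => TangentSpace (𝓡 n) x)]

theorem mfderiv_symm_invertible (x : M) {u : EuclideanSpace ℝ (Fin n)}
    (hu : u ∈ (extChartAt (𝓡 n) x).target) :
    (mfderiv 𝓘(ℝ, EuclideanSpace ℝ (Fin n)) (𝓡 n) (extChartAt (𝓡 n) x).symm u).IsInvertible := by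
  have : IsManifold (𝓡 n) 1 M := .of_le (n := ∞) (by simp)
  have h := isInvertible_mfderivWithin_extChartAt_symm (I := 𝓡 n) hu
  rwa [ModelWithCorners.range_eq_univ, mfderivWithin_univ] at h

theorem continuousOn_gram (x : M) :
    ContinuousOn (gram (n := n) x) (extChartAt (𝓡 n) x).target := by
  have : IsManifold (𝓡 n) 1 M := .of_le (n := ∞) (by simp)
  have hR : IsContinuousRiemannianBundle (EuclideanSpace ℝ (Fin n))
      (fun x : M => TangentSpace (𝓡 n) x) := by
    obtain ⟨g, hg, hg'⟩ := IsContMDiffRiemannianBundle.exists_contMDiff (IB := 𝓡 n) (n := ∞)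
      (F := EuclideanSpace ℝ (Fin n)) (E := fun x : M => TangentSpace (𝓡 n) x)
    exact ⟨g, hg.continuous, hg'⟩
  have hopen : IsOpen (extChartAt (𝓡 n) x).target := isOpen_extChartAt_target x
  have hs : ContMDiffOn 𝓘(ℝ, EuclideanSpace ℝ (Fin n)) (𝓡 n) 1 (extChartAt (𝓡 n) x).symm
      (extChartAt (𝓡 n) x).target := contMDiffOn_extChartAt_symm x
  have ht := hs.continuousOn_tangentMapWithin le_rfl hopen.uniqueMDiffOn
  have hv : ∀ i : Fin n, ContinuousOn (fun u =>
      (⟨(extChartAt (𝓡 n) x).symm u,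
        mfderiv 𝓘(ℝ, EuclideanSpace ℝ (Fin n)) (𝓡 n) (extChartAt (𝓡 n) x).symm u
          (EuclideanSpace.single i 1)⟩ : TangentBundle (𝓡 n) M)) (extChartAt (𝓡 n) x).target := by
    intro i
    have hc : Continuous (fun u : EuclideanSpace ℝ (Fin n) =>
        (⟨u, EuclideanSpace.single i 1⟩ :
          TangentBundle 𝓘(ℝ, EuclideanSpace ℝ (Fin n)) (EuclideanSpace ℝ (Fin n)))) := by
      rw [← (tangentBundleModelSpaceHomeomorph
        𝓘(ℝ, EuclideanSpace ℝ (Fin n))).comp_continuous_iff]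
      exact continuous_id.prodMk continuous_const
    refine (ht.comp hc.continuousOn (fun u hu => hu)).congr fun u hu => ?_
    simp only [Function.comp, tangentMapWithin]
    rw [mfderivWithin_of_isOpen hopen hu]
  refine continuousOn_pi.mpr fun i => continuousOn_pi.mpr fun j => ?_
  exact ContinuousOn.inner_bundle (hv i) (hv j)

/-- The coordinate basis of the tangent space at the point with coordinates `u`. -/
def chartBasis (x : M) {u : EuclideanSpace ℝ (Fin n)} (hu : u ∈ (extChartAt (𝓡 n) x).target) :
    Module.Basis (Fin n) ℝ (TangentSpace (𝓡 n) ((extChartAt (𝓡 n) x).symm u)) :=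
  (EuclideanSpace.basisFun (Fin n) ℝ).toBasis.map
    (mfderiv_symm_invertible x hu).choose.toLinearEquiv

theorem chartBasis_apply (x : M) {u : EuclideanSpace ℝ (Fin n)}
    (hu : u ∈ (extChartAt (𝓡 n) x).target) (i : Fin n) :
    chartBasis x hu i = mfderiv 𝓘(ℝ, EuclideanSpace ℝ (Fin n)) (𝓡 n) (extChartAt (𝓡 n) x).symm u
      (EuclideanSpace.single i 1) := by
  have h := congrArg (fun L : EuclideanSpace ℝ (Fin n) →L[ℝ]
    TangentSpace (𝓡 n) ((extChartAt (𝓡 n) x).symm u) => L (EuclideanSpace.single i 1))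
    (mfderiv_symm_invertible x hu).choose_spec
  refine Eq.trans (Module.Basis.map_apply _ _ _) ?_
  rw [OrthonormalBasis.coe_toBasis, EuclideanSpace.basisFun_apply]
  exact h

theorem gram_eq (x : M) {u : EuclideanSpace ℝ (Fin n)} (hu : u ∈ (extChartAt (𝓡 n) x).target) :
    gram x u = Matrix.of fun i j => inner ℝ (chartBasis x hu i) (chartBasis x hu j) := by
  ext i j
  simp only [gram, Matrix.of_apply, chartBasis_apply]

theorem det_gram_ne_zero (x : M) {u : EuclideanSpace ℝ (Fin n)}
    (hu : u ∈ (extChartAt (𝓡 n) x).target) : (gram x u).det ≠ 0 := by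
  intro h0
  obtain ⟨v, hv, hv0⟩ := Matrix.exists_mulVec_eq_zero_iff.mpr h0
  apply hv
  rw [gram_eq x hu] at hv0
  set w := ∑ j, v j • chartBasis x hu j with hw
  have h1 : ∀ i, inner ℝ (chartBasis x hu i) w = 0 := by
    intro i
    have := congrFun hv0 i
    simp only [Matrix.mulVec, dotProduct, Matrix.of_apply, Pi.zero_apply] at this
    rw [hw, inner_sum, ← this]
    exact Finset.sum_congr rfl fun j _ => by rw [inner_smul_right, mul_comm]
  have h2 : w = 0 := by
    have h3 : inner ℝ w w = ∑ j, inner ℝ (v j • chartBasis x hu j) w := by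
      rw [← sum_inner]
    rw [← inner_self_eq_zero (𝕜 := ℝ), h3]
    exact Finset.sum_eq_zero fun j _ => by rw [inner_smul_left, h1]; simp
  have h3 := (Fintype.linearIndependent_iff.mp (chartBasis x hu).linearIndependent) v (hw ▸ h2)
  exact funext h3

theorem continuous_pairing [PathConnectedSpace M] {ρ : FundamentalGroup M x₀ →* (V ≃ₗᵢ[ℝ] V)}
    {k : ℕ} {α β : RawForm n V x₀ k} (hα : α ∈ smoothForms n ρ k) (hβ : β ∈ smoothForms n ρ k) :
    Continuous (pairing α β) := by
  rw [continuous_iff_continuousAt]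
  intro x
  set φ := extChartAt (𝓡 n) x with hφ
  let c : Path.Homotopic.Quotient x₀ x := .mk (PathConnectedSpace.somePath x₀ x)
  let F : EuclideanSpace ℝ (Fin n) → ℝ := fun u => ((k.factorial : ℝ))⁻¹ *
    ∑ p : Fin k → Fin n, ∑ q : Fin k → Fin n,
      (∏ l, (gram x u)⁻¹ (p l) (q l)) *
        inner ℝ (localRep α x c u fun l => EuclideanSpace.single (p l) 1)
          (localRep β x c u fun l => EuclideanSpace.single (q l) 1)
  have hopen : IsOpen φ.target := isOpen_extChartAt_target x
  have hmem : φ x ∈ φ.target := mem_extChartAt_target x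
  have hF : ContinuousAt F (φ x) := by
    have hG : ContinuousAt (gram (n := n) x) (φ x) :=
      (continuousOn_gram x).continuousAt (hopen.mem_nhds hmem)
    have hGi : ContinuousAt (fun u => (gram (n := n) x u)⁻¹) (φ x) := by
      simp only [Matrix.inv_def, Ring.inverse_eq_inv']
      have h1 : ContinuousAt (fun u => (gram (n := n) x u).det) (φ x) :=
        (Continuous.matrix_det continuous_id).continuousAt.comp hG
      have h2 : ContinuousAt (fun u => (gram (n := n) x u).adjugate) (φ x) :=
        (Continuous.matrix_adjugate continuous_id).continuousAt.comp hG
      exact (h1.inv₀ (det_gram_ne_zero x hmem)).smul h2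
    have hev : ∀ {γ : RawForm n V x₀ k}, γ ∈ smoothForms n ρ k → ∀ v,
        ContinuousAt (fun u => localRep γ x c u v) (φ x) := by
      intro γ hγ v
      exact ((ContinuousAlternatingMap.apply ℝ (EuclideanSpace ℝ (Fin n)) V
        v).continuous.continuousAt (x := localRep γ x c (φ x))).comp (hγ.2 x c).continuousAt
    refine continuousAt_const.mul (tendsto_finsetSum _ fun p _ => tendsto_finsetSum _ fun q _ => ?_)
    refine ContinuousAt.mul ?_ ((hev hα _).inner (hev hβ _))
    refine tendsto_finsetProd _ fun l _ => ?_
    exact (continuousAt_pi.mp (continuousAt_pi.mp hGi (p l)) (q l))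
  have heq : pairing α β =ᶠ[𝓝 x] fun y => F (φ y) := by
    obtain ⟨r, hr, hball⟩ := Metric.isOpen_iff.mp hopen _ hmem
    have h1 : ∀ᶠ y in 𝓝 x, φ y ∈ Metric.ball (φ x) r :=
      (continuousAt_extChartAt x).eventually (Metric.ball_mem_nhds _ hr)
    filter_upwards [h1, extChartAt_source_mem_nhds (I := 𝓡 n) x] with y hy hys
    have hseg : segment ℝ (φ x) (φ y) ⊆ φ.target :=
      ((convex_ball (φ x) r).segment_subset (Metric.mem_ball_self hr) hy).trans hball
    obtain ⟨u, hu, rfl⟩ : ∃ u ∈ φ.target, y = φ.symm u :=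
      ⟨φ y, φ.map_source hys, (φ.left_inv hys).symm⟩
    rw [φ.right_inv hu] at hseg ⊢
    rw [pairing_eq hα hβ _ (c.trans (.mk (chartRay x u hseg))),
      altInner_eq_gram (chartBasis x hu), ← gram_eq x hu]
    simp only [F, localRep]
    rw [dif_pos hseg]
    rw [dif_pos hseg]
    simp only [chartBasis_apply]
    rfl
  exact (ContinuousAt.comp (f := φ) (g := F) hF (continuousAt_extChartAt x)).congr heq.symm

section Volume

variable [MeasurableSpace M] [BorelSpace M]

/-- The measure on the domain of the chart `φ` at `x` which is `√(det g) du` in coordinates. -/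
def chartVolume (x : M) : Measure M :=
  ((volume.restrict (extChartAt (𝓡 n) x).target).withDensity
    fun u => ENNReal.ofReal (√(gram (n := n) x u).det)).map (extChartAt (𝓡 n) x).symm

variable [CompactSpace M] [T2Space M]

variable (n M) in
/-- A partition of unity subordinate to the domains of the charts. -/
def chartPartition : SmoothPartitionOfUnity M (𝓡 n) M univ :=
  (SmoothPartitionOfUnity.exists_isSubordinate_chartAt_source (𝓡 n) M).choose

variable (n M) in
/-- The Riemannian volume measure `∑ f_x √(det g) du` of a closed Riemannian manifold. -/
def riemannianVolume : Measure M :=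
  Measure.sum fun x => (chartVolume (n := n) x).withDensity
    fun y => ENNReal.ofReal (chartPartition n M x y)

theorem chartVolume_lt_top (x : M) {K : Set M} (hK : IsCompact K)
    (hKx : K ⊆ (chartAt (EuclideanSpace ℝ (Fin n)) x).source) :
    chartVolume (n := n) x K < ⊤ := by
  set φ := extChartAt (𝓡 n) x with hφ
  have hopen : IsOpen φ.target := isOpen_extChartAt_target x
  have hKx' : K ⊆ φ.source := by rwa [hφ, extChartAt_source]
  have hm : AEMeasurable φ.symm ((volume.restrict φ.target).withDensity
      fun u => ENNReal.ofReal (√(gram (n := n) x u).det)) :=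
    ((continuousOn_extChartAt_symm x).aemeasurable hopen.measurableSet).mono_ac
      (withDensity_absolutelyContinuous _ _)
  have hL : IsCompact (φ '' K) := hK.image_of_continuousOn
    ((continuousOn_extChartAt x).mono hKx')
  have hLt : φ '' K ⊆ φ.target := by
    rintro _ ⟨y, hy, rfl⟩; exact φ.map_source (hKx' hy)
  have hcont : ContinuousOn (fun u => √(gram (n := n) x u).det) φ.target :=
    ((Continuous.matrix_det continuous_id).comp_continuousOn (continuousOn_gram x)).sqrt
  obtain ⟨C, hC⟩ := hL.exists_bound_of_continuousOn (hcont.mono hLt)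
  rw [chartVolume, Measure.map_apply_of_aemeasurable hm hK.measurableSet]
  calc _ ≤ ((volume.restrict φ.target).withDensity
          fun u => ENNReal.ofReal (√(gram (n := n) x u).det)) (φ '' K ∪ φ.targetᶜ) := by
        refine measure_mono fun u hu => ?_
        by_cases hut : u ∈ φ.target
        · exact Or.inl ⟨_, hu, φ.right_inv hut⟩
        · exact Or.inr hut
    _ ≤ ((volume.restrict φ.target).withDensity
          fun u => ENNReal.ofReal (√(gram (n := n) x u).det)) (φ '' K) +
        ((volume.restrict φ.target).withDensity
          fun u => ENNReal.ofReal (√(gram (n := n) x u).det)) φ.targetᶜ := measure_union_le _ _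
    _ = ((volume.restrict φ.target).withDensity
          fun u => ENNReal.ofReal (√(gram (n := n) x u).det)) (φ '' K) := by
        have h0 : (volume.restrict φ.target) φ.targetᶜ = 0 := by
          rw [Measure.restrict_apply hopen.measurableSet.compl]; simp
        rw [withDensity_absolutelyContinuous _ _ h0, add_zero]
    _ = ∫⁻ u in φ '' K, ENNReal.ofReal (√(gram (n := n) x u).det) ∂(volume.restrict φ.target) :=
        withDensity_apply _ hL.measurableSet
    _ ≤ ∫⁻ u in φ '' K, ENNReal.ofReal C ∂(volume.restrict φ.target) := by
        refine setLIntegral_mono measurable_const fun u hu => ENNReal.ofReal_le_ofReal ?_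
        exact (le_abs_self _).trans (hC u hu)
    _ < ⊤ := by
        rw [setLIntegral_const]
        exact ENNReal.mul_lt_top ENNReal.ofReal_lt_top
          ((Measure.restrict_apply_le _ _).trans_lt hL.measure_lt_top)

instance isFiniteMeasure_riemannianVolume : IsFiniteMeasure (riemannianVolume n M) := by
  refine ⟨?_⟩
  have hsub := (SmoothPartitionOfUnity.exists_isSubordinate_chartAt_source (𝓡 n) M).choose_spec
  rw [riemannianVolume, Measure.sum_apply _ MeasurableSet.univ]
  have hfin : {x : M | (Function.support (chartPartition n M x)).Nonempty}.Finite :=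
    (chartPartition n M).locallyFinite.finite_nonempty_of_compact
  have hle : ∀ x : M, ((chartVolume (n := n) x).withDensity
      fun y => ENNReal.ofReal (chartPartition n M x y)) univ < ⊤ := by
    intro x
    have hK : IsCompact (tsupport (chartPartition n M x)) := (isClosed_tsupport _).isCompact
    rw [withDensity_apply _ MeasurableSet.univ, Measure.restrict_univ]
    refine lt_of_le_of_lt (b := chartVolume (n := n) x (tsupport (chartPartition n M x))) ?_
      (chartVolume_lt_top x hK (hsub x))
    rw [← lintegral_indicator_one hK.measurableSet]
    refine lintegral_mono fun y => ?_
    by_cases hy : y ∈ tsupport (chartPartition n M x)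
    · rw [indicator_of_mem hy]
      exact ENNReal.ofReal_le_one.mpr ((chartPartition n M).le_one x y)
    · rw [image_eq_zero_of_notMem_tsupport hy]; simp
  rw [tsum_eq_sum (s := hfin.toFinset)]
  · exact ENNReal.sum_lt_top.mpr fun x _ => hle x
  · intro x hx
    have hx' : ∀ y, chartPartition n M x y = 0 := by
      intro y
      by_contra hy
      exact hx (hfin.mem_toFinset.mpr ⟨y, hy⟩)
    simp [hx']

theorem integrable_pairing [PathConnectedSpace M] {ρ : FundamentalGroup M x₀ →* (V ≃ₗᵢ[ℝ] V)}
    {k : ℕ} {α β : RawForm n V x₀ k} (hα : α ∈ smoothForms n ρ k) (hβ : β ∈ smoothForms n ρ k) :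
    Integrable (pairing α β) (riemannianVolume n M) :=
  (continuous_pairing hα hβ).integrable_of_hasCompactSupport (HasCompactSupport.of_compactSpace _)

end Volume

end Riemannian

variable (n) in
/-- `Ωᵏ`, the space of smooth `k`-forms with values in `E(ρ)`, as an `L²` inner product space. -/
def TwistedForm (ρ : FundamentalGroup M x₀ →* (V ≃ₗᵢ[ℝ] V)) (k : ℕ) : Type _ :=
  smoothForms n ρ k

variable {ρ : FundamentalGroup M x₀ →* (V ≃ₗᵢ[ℝ] V)}

instance (k : ℕ) : AddCommGroup (TwistedForm n ρ k) :=
  inferInstanceAs (AddCommGroup (smoothForms n ρ k))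

instance (k : ℕ) : Module ℝ (TwistedForm n ρ k) :=
  inferInstanceAs (Module ℝ (smoothForms n ρ k))

variable (n ρ) in
/-- The exterior differential on `Ωᵏ`. -/
def dLinear (k : ℕ) : TwistedForm n ρ k →ₗ[ℝ] RawForm n V x₀ (k + 1) where
  toFun α := extD α.1
  map_add' α β := by
    funext x c
    have hα : DifferentiableAt ℝ (localRep α.1 x c) (extChartAt (𝓡 n) x x) :=
      (α.2.2 x c).differentiableAt (by simp)
    have hβ : DifferentiableAt ℝ (localRep β.1 x c) (extChartAt (𝓡 n) x x) :=
      (β.2.2 x c).differentiableAt (by simp)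
    change extD (α.1 + β.1) x c = extD α.1 x c + extD β.1 x c
    simp only [extD]
    rw [localRep_add, extDeriv_add hα hβ]
    rfl
  map_smul' r α := by
    funext x c
    change extD (r • α.1) x c = r • extD α.1 x c
    simp only [extD]
    rw [localRep_smul, extDeriv_smul]
    rfl

variable (n ρ) in
/-- The exact part `Ω'ₖ = Im d_{k-1}` of `Ωᵏ` (zero for `k = 0`). -/
def exactForms : (k : ℕ) → Submodule ℝ (TwistedForm n ρ k)
  | 0 => ⊥
  | k + 1 => (LinearMap.range (dLinear n ρ k)).comap (smoothForms n ρ (k + 1)).subtype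

variable (n ρ) in
/-- All cohomology groups `H^k(M, ρ)` vanish: every closed form is exact. -/
def IsAcyclic : Prop := ∀ k : ℕ, LinearMap.ker (dLinear n ρ k) ≤ exactForms n ρ k

section L2

variable [RiemannianBundle (fun x : M => TangentSpace (𝓡 n) x)] [IsManifold (𝓡 n) ∞ M]
  [IsContMDiffRiemannianBundle (𝓡 n) ∞ (EuclideanSpace ℝ (Fin n))
    (fun x : M => TangentSpace (𝓡 n) x)]
  [MeasurableSpace M] [BorelSpace M] [CompactSpace M] [T2Space M] [PathConnectedSpace M]

variable (n ρ) in
/-- The `L²` inner product on `Ωᵏ`. -/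
@[reducible] def l2Core (k : ℕ) : PreInnerProductSpace.Core ℝ (TwistedForm n ρ k) where
  inner α β := ∫ x, pairing α.1 β.1 x ∂(riemannianVolume n M)
  conj_inner_symm α β := by
    simp only [conj_trivial]
    exact integral_congr_ae (.of_forall fun x => altInner_comm _ _)
  re_inner_nonneg α := integral_nonneg fun x => altInner_self_nonneg _
  add_left α β γ := by
    rw [← integral_add (integrable_pairing α.2 γ.2) (integrable_pairing β.2 γ.2)]
    exact integral_congr_ae (.of_forall fun x => altInner_add_left _ _ _)
  smul_left α β r := by
    simp only [conj_trivial]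
    rw [← integral_const_mul]
    exact integral_congr_ae (.of_forall fun x => altInner_smul_left _ _ _)

instance (k : ℕ) : SeminormedAddCommGroup (TwistedForm n ρ k) :=
  @InnerProductSpace.Core.toSeminormedAddCommGroup ℝ _ _ _ _ (l2Core n ρ k)

instance (k : ℕ) : InnerProductSpace ℝ (TwistedForm n ρ k) :=
  @InnerProductSpace.ofCore ℝ _ _ _ _ (l2Core n ρ k)

theorem inner_def {k : ℕ} (α β : TwistedForm n ρ k) :
    inner ℝ α β = ∫ x, pairing α.1 β.1 x ∂(riemannianVolume n M) := rfl

variable (n ρ) in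
/-- The Hilbert space `Hₖ = L²(Ωᵏ)`, the completion of `Ωᵏ` for the `L²` inner product. -/
abbrev L2Forms (k : ℕ) : Type _ := UniformSpace.Completion (TwistedForm n ρ k)

variable (n ρ) in
/-- The closed subspace `H'ₖ` of `Hₖ`, the closure of the exact forms. -/
abbrev L2Exact (k : ℕ) : Submodule ℝ (L2Forms n ρ k) :=
  ((exactForms n ρ k).map
    (UniformSpace.Completion.toComplL (𝕜 := ℝ) (E := TwistedForm n ρ k)).toLinearMap
    ).topologicalClosure

variable (n ρ) in
/-- The projection `α ↦ α'` of `Hₖ = H'ₖ ⊕ H''ₖ` onto `H'ₖ`; `H''ₖ` is the orthogonal complement. -/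
def exactPart (k : ℕ) : L2Forms n ρ k →L[ℝ] L2Exact n ρ k := 
  (L2Exact n ρ k).orthogonalProjectionOnto

end L2

end Manifold

section Gaussian

variable {H K : Type*} [NormedAddCommGroup H] [InnerProductSpace ℝ H] [CompleteSpace H]
  [NormedAddCommGroup K] [InnerProductSpace ℝ K] [CompleteSpace K]

variable (H K) in
/-- A Hilbert-Schmidt extension of the Hilbert space `H`: a Hilbert space `K` in which `H` is
embedded densely by an injective Hilbert-Schmidt operator. -/
structure HilbertSchmidtExtension where
  incl : H →L[ℝ] K
  injective : Function.Injective incl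
  denseRange : DenseRange incl
  hilbertSchmidt : ∀ s : Set H, Orthonormal ℝ ((↑) : s → H) →
    Summable fun e : s => ‖incl e‖ ^ 2

namespace HilbertSchmidtExtension

variable (J : HilbertSchmidtExtension H K)

/-- The Hilbert space `K` is its own dual, and `y : K` restricts to a continuous linear form on `H`,
that is, to a vector `J.test y` of `H` with `⟪J.test y, ξ⟫ = ⟪y, ξ⟫` for `ξ` in `H`. The vectors of
this form, the test vectors, are those vectors of `H` whose pairing with `H` extends continuously
to `K`, the pairing of `J.test y` with `φ` in `K` being `⟪y, φ⟫`. -/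
def test : K →L[ℝ] H := ContinuousLinearMap.adjoint J.incl

theorem inner_test (y : K) (ξ : H) : inner ℝ (J.test y) ξ = inner ℝ y (J.incl ξ) :=
  ContinuousLinearMap.adjoint_inner_left _ _ _

theorem test_injective : Function.Injective J.test := by
  rw [injective_iff_map_eq_zero]
  intro y hy
  have h : ∀ z : K, inner ℝ y z = 0 := fun z =>
    J.denseRange.induction_on (p := fun z => inner ℝ y z = 0) z
      (isClosed_eq (by fun_prop) continuous_const) fun ξ => by
        rw [← J.inner_test, hy, inner_zero_left]
  exact inner_self_eq_zero.mp (h y)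

theorem exists_truncation (F : Finset K) (η : K) :
    ∃ z ∈ Submodule.span ℝ (F : Set K), ∀ y ∈ Submodule.span ℝ (F : Set K),
      inner ℝ (J.test y) (J.test z) = inner ℝ y η := by
  let S := Submodule.span ℝ (F : Set K)
  have : FiniteDimensional ℝ S := FiniteDimensional.span_finset ℝ F
  let B : S →ₗ[ℝ] Module.Dual ℝ S := LinearMap.mk₂ ℝ
    (fun z y => inner ℝ (J.test y) (J.test z))
    (by intros; simp [inner_add_right]) (by intros; simp [inner_smul_right])
    (by intros; simp [inner_add_left]) (by intros; simp [inner_smul_left])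
  have hB : Function.Injective B := by
    rw [injective_iff_map_eq_zero]
    intro z hz
    have h1 : inner ℝ (J.test z) (J.test z) = 0 := LinearMap.congr_fun hz z
    have h2 := J.test_injective ((inner_self_eq_zero.mp h1).trans (map_zero J.test).symm)
    exact Subtype.ext h2
  have hs : Function.Surjective B :=
    (LinearMap.injective_iff_surjective_of_finrank_eq_finrank
      (Subspace.dual_finrank_eq (K := ℝ) (V := S)).symm).mp hB
  obtain ⟨z, hz⟩ := hs ((innerₗ K η).comp S.subtype)
  refine ⟨z, z.2, fun y hy => ?_⟩
  have := LinearMap.congr_fun hz ⟨y, hy⟩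
  rw [real_inner_comm η y]
  exact this

/-- The truncation of a generalized vector `η` in `K` to the finite-dimensional space of test vectors
spanned by `J.test y` for `y ∈ F`: the element `z` of the span of `F` for which `J.test z` is the
orthogonal projection of `η` to this space, that is,
`⟪J.test y, J.test z⟫ = ⟪J.test y, η⟫` (the pairing of test vectors and generalized vectors, which
is `⟪y, η⟫`) for all `y` in the span of `F`. -/
def truncate (F : Finset K) (η : K) : K := (J.exists_truncation F η).choose

/-- The extension to `K` of a function `ξ ↦ χ ξ` of test vectors: its value at `η` in `K` is the
limit of its values at the truncations of `η`, along the directed set of the finite-dimensional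
spaces of test vectors. Here `χ` is written as a function of `y`, with `ξ = J.test y`. -/
def extend (χ : K → ℂ) (η : K) : ℂ :=
  limUnder atTop fun F : Finset K => χ (J.truncate F η)

/-- `μ` is the Gaussian measure on the extension `K` of `H` with characteristic function
`ξ ↦ exp (-(a / 2) ⟪ξ, ξ⟫)`: for every test vector `ξ = J.test y`, the integral of
`φ ↦ exp (i ⟪ξ, φ⟫)` is `exp (-(a / 2) ⟪ξ, ξ⟫)`. -/
structure IsGaussian [MeasurableSpace K] (a : ℝ) (μ : Measure K) : Prop where
  isProbabilityMeasure : IsProbabilityMeasure μ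
  charFun_eq : ∀ y : K, charFun μ y = Complex.exp (-(a / 2) * ‖J.test y‖ ^ 2 : ℝ)

end HilbertSchmidtExtension

end Gaussian

end TwistedForms

end

/-! Push `μ` forward along `Q`, so that both measures live on `K'`. The truncated identity is then a
Parseval formula, valid for any two finite measures. Truncation is symmetric for the pairing of `K'`
(`inner_truncate_left`), so Fubini applied to `exp (i ⟪φ, P_F η⟫)` exchanges the measures
(`integral_charFun_truncate_comm`).

For the limits, Gaussianity enters. Since `J.test ∘ Q* = P* ∘ J'.test` and `P*` is the inclusion of
the closed subspace (`test_adjoint`), both characteristic functions have the form `exp (-(c/2)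
‖J'.test y‖²)`. The squared norm of the truncation of `η` is the maximum of `2⟪y, η⟫ - ‖J'.test y‖²`
over the span of `F`. It therefore grows with `F`, and the exponential decreases to its infimum.

A limit along the uncountable family of finite sets is not suited to integration. As `K'` is
separable and the functional above is continuous in `y`, the same infimum is reached along finite
pieces of one dense sequence (`exists_tendsto_exp_truncate`). Dominated convergence with bound `1`
then carries the truncated identity to the limit. -/

namespace TwistedForms

namespace HilbertSchmidtExtension

/-! ### Truncations: symmetry, continuity, and the variational formula -/

section Truncation

variable {H K : Type*} [NormedAddCommGroup H] [InnerProductSpace ℝ H] [CompleteSpace H]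
  [NormedAddCommGroup K] [InnerProductSpace ℝ K] [CompleteSpace K]
  (J : HilbertSchmidtExtension H K)

/-- A Hilbert-Schmidt extension of a Hilbert space is separable. -/
theorem separableSpace (J : HilbertSchmidtExtension H K) :
    TopologicalSpace.SeparableSpace K := by
  obtain ⟨w, e, he⟩ := exists_hilbertBasis ℝ H
  have horth : Orthonormal ℝ ((↑) : w → H) := he ▸ e.orthonormal
  -- By injectivity no term of the Hilbert–Schmidt sum vanishes, so summability forces the
  -- orthonormal basis to be countable.
  have hsupp : (Function.support fun x : w => ‖J.incl x‖ ^ 2) = Set.univ := by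
    refine Set.eq_univ_of_forall fun x hx => horth.ne_zero x ?_
    exact (map_eq_zero_iff J.incl J.injective).mp (by simpa using hx)
  have hcount : Countable w := by
    rw [← Set.countable_univ_iff, ← hsupp]
    exact (J.hilbertSchmidt w horth).countable_support
  have hH : TopologicalSpace.SeparableSpace H := by
    rw [← TopologicalSpace.isSeparable_univ_iff]
    have h1 : TopologicalSpace.IsSeparable
        ((Submodule.span ℝ (Set.range e)).topologicalClosure : Set H) := by
      rw [Submodule.topologicalClosure_coe]
      exact ((Set.countable_range e).isSeparable.span (R := ℝ)).closure
    rwa [e.dense_span] at h1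
  exact J.denseRange.separableSpace J.incl.continuous

theorem truncate_mem (F : Finset K) (η : K) :
    J.truncate F η ∈ Submodule.span ℝ (F : Set K) :=
  (J.exists_truncation F η).choose_spec.1

theorem inner_test_truncate {F : Finset K} (η : K) {y : K}
    (hy : y ∈ Submodule.span ℝ (F : Set K)) :
    inner ℝ (J.test y) (J.test (J.truncate F η)) = inner ℝ y η :=
  (J.exists_truncation F η).choose_spec.2 y hy

/-- The difference of two solutions lies in the span and has an image under `J.test` orthogonal to
itself, so it is zero by injectivity. This lets the chosen `truncate` be identified with explicit
formulas. -/
theorem truncate_eq_of_forall {F : Finset K} {η z : K}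
    (hz : z ∈ Submodule.span ℝ (F : Set K))
    (h : ∀ y ∈ Submodule.span ℝ (F : Set K),
      inner ℝ (J.test y) (J.test z) = inner ℝ y η) : J.truncate F η = z := by
  have hmem := Submodule.sub_mem _ (J.truncate_mem F η) hz
  have h0 : inner ℝ (J.test (J.truncate F η - z)) (J.test (J.truncate F η - z)) = (0 : ℝ) := by
    conv_lhs => arg 3; rw [map_sub]
    rw [inner_sub_right, J.inner_test_truncate η hmem, h _ hmem, sub_self]
  exact sub_eq_zero.mp
    (J.test_injective ((inner_self_eq_zero.mp h0).trans (map_zero J.test).symm))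

/-- Lifting an orthonormal basis of the space of test vectors to `y i` in the span of `F` gives the
formula `∑ i, ⟪y i, η⟫ • y i`. Continuity supplies the measurability needed for every integral
below. -/
theorem continuous_truncate (F : Finset K) : Continuous (J.truncate F) := by
  let S := Submodule.span ℝ (F : Set K)
  have : FiniteDimensional ℝ S := FiniteDimensional.span_finset ℝ F
  let E : Submodule ℝ H := S.map J.test.toLinearMap
  have : FiniteDimensional ℝ E := inferInstance
  let e := stdOrthonormalBasis ℝ E
  have hex : ∀ i, ∃ y ∈ S, J.test y = e i := fun i => (e i).2
  choose y hyS hy using hex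
  have hT : J.truncate F = fun η => ∑ i, (inner ℝ (y i) η : ℝ) • y i := by
    funext η
    refine J.truncate_eq_of_forall
      (Submodule.sum_mem _ fun i _ => Submodule.smul_mem _ _ (hyS i)) fun x hx => ?_
    let v : E := ⟨J.test x, x, hx, rfl⟩
    -- The `y i` span the span of `F`: the expansion of `J.test x` in `e` lifts because `J.test` is
    -- injective.
    have hx' : x = ∑ i, (inner ℝ (e i) v : ℝ) • y i := by
      apply J.test_injective
      have := congrArg (Subtype.val) (e.sum_repr' v)
      simp only [map_sum, map_smul, hy]
      simpa [v] using this.symm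
    have hc : ∀ i, inner ℝ (J.test x) (e i : H) = (inner ℝ (e i) v : ℝ) := fun i => by
      rw [real_inner_comm]; rfl
    conv_rhs => rw [hx']
    simp only [map_sum, map_smul, hy, inner_sum, sum_inner, real_inner_smul_left,
      real_inner_smul_right, hc]
    exact Finset.sum_congr rfl fun i _ => mul_comm _ _
  rw [hT]
  fun_prop

/-- Both sides are the inner product in `H` of the two projected vectors. -/
theorem inner_truncate_left (F : Finset K) (η φ : K) :
    (inner ℝ (J.truncate F η) φ : ℝ) = inner ℝ (J.truncate F φ) η := by
  rw [← J.inner_test_truncate φ (J.truncate_mem F η),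
    ← J.inner_test_truncate η (J.truncate_mem F φ), real_inner_comm]

/-- Expand `0 ≤ ‖J.test y - J.test (J.truncate F η)‖²`. The left side does not involve `F`, so
different finite sets can be compared. -/
theorem two_mul_inner_sub_le {F : Finset K} (η : K) {y : K}
    (hy : y ∈ Submodule.span ℝ (F : Set K)) :
    2 * inner ℝ y η - ‖J.test y‖ ^ 2 ≤ ‖J.test (J.truncate F η)‖ ^ 2 := by
  have h := norm_sub_sq_real (J.test y) (J.test (J.truncate F η))
  rw [J.inner_test_truncate η hy] at h
  nlinarith [sq_nonneg ‖J.test y - J.test (J.truncate F η)‖]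

/-- The case of equality `y = J.truncate F η` of the preceding bound, which makes it a maximum over
the span. -/
theorem norm_test_truncate_sq (F : Finset K) (η : K) :
    ‖J.test (J.truncate F η)‖ ^ 2 =
      2 * inner ℝ (J.truncate F η) η - ‖J.test (J.truncate F η)‖ ^ 2 := by
  rw [← J.inner_test_truncate η (J.truncate_mem F η), real_inner_self_eq_norm_sq]
  ring

/-- A maximum over a larger span is larger. -/
theorem monotone_norm_test_truncate_sq (η : K) :
    Monotone fun F : Finset K => ‖J.test (J.truncate F η)‖ ^ 2 := by
  intro F G h
  change ‖J.test (J.truncate F η)‖ ^ 2 ≤ _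
  rw [J.norm_test_truncate_sq F η]
  exact J.two_mul_inner_sub_le η (Submodule.span_mono (Finset.coe_subset.mpr h)
    (J.truncate_mem F η))

/-- The limit of `exp (-(c / 2) ‖·‖²)` at the truncations of `η` exists, and it is attained along
any sequence of finite sets that exhausts a dense sequence. -/
theorem exists_tendsto_exp_truncate {c : ℝ} (hc : 0 ≤ c) {s : ℕ → K} (hs : DenseRange s)
    {G : ℕ → Finset K} (hG : Monotone G) (hsG : ∀ m, ∃ n, s m ∈ G n) (η : K) :
    ∃ L : ℝ, Tendsto (fun F : Finset K => Real.exp (-(c / 2) * ‖J.test (J.truncate F η)‖ ^ 2))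
        atTop (𝓝 L) ∧
      Tendsto (fun n => Real.exp (-(c / 2) * ‖J.test (J.truncate (G n) η)‖ ^ 2))
        atTop (𝓝 L) := by
  set g : Finset K → ℝ := fun F => Real.exp (-(c / 2) * ‖J.test (J.truncate F η)‖ ^ 2)
  have hanti : Antitone g := fun F F' h => Real.exp_le_exp.mpr
    (mul_le_mul_of_nonpos_left (J.monotone_norm_test_truncate_sq η h) (by linarith))
  have hbdd : BddBelow (Set.range g) := ⟨0, by rintro _ ⟨F, rfl⟩; exact (Real.exp_pos _).le⟩
  have hbdd' : BddBelow (Set.range (g ∘ G)) := hbdd.mono (Set.range_comp_subset_range _ _)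
  have h1 := tendsto_atTop_ciInf hanti hbdd
  have h2 := tendsto_atTop_ciInf (hanti.comp_monotone hG) hbdd'
  have heq : ⨅ F, g F = ⨅ n, (g ∘ G) n := by
    refine le_antisymm (le_ciInf fun n => ciInf_le hbdd (G n)) (le_ciInf fun F => ?_)
    -- The right side is continuous in `y`, so it is enough to test `y = s m`, which lies in some `G
    -- n`. Taking `y = J.truncate F η` afterwards turns the right side into `g F`.
    have key : ∀ y : K, ⨅ n, (g ∘ G) n ≤
        Real.exp (-(c / 2) * (2 * inner ℝ y η - ‖J.test y‖ ^ 2)) := fun y =>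
      hs.induction_on (p := fun y => ⨅ n, (g ∘ G) n ≤
        Real.exp (-(c / 2) * (2 * inner ℝ y η - ‖J.test y‖ ^ 2))) y
        (isClosed_le continuous_const (by fun_prop)) fun m => by
          obtain ⟨n, hn⟩ := hsG m
          refine (ciInf_le hbdd' n).trans (Real.exp_le_exp.mpr
            (mul_le_mul_of_nonpos_left ?_ (by linarith)))
          exact J.two_mul_inner_sub_le η (Submodule.subset_span hn)
    have := key (J.truncate F η)
    rwa [← J.norm_test_truncate_sq F η] at this
  exact ⟨_, h1, heq ▸ h2⟩

end Truncation

/-! ### Parseval identity for truncations and passage to the limit -/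

section Parseval

variable {H K : Type*} [NormedAddCommGroup H] [InnerProductSpace ℝ H] [CompleteSpace H]
  [NormedAddCommGroup K] [InnerProductSpace ℝ K] [CompleteSpace K]
  [MeasurableSpace K] [BorelSpace K] (J : HilbertSchmidtExtension H K)

theorem integrable_charFun_truncate (μ ν : Measure K) [IsFiniteMeasure μ] [IsFiniteMeasure ν]
    (F : Finset K) : Integrable (fun η => charFun μ (J.truncate F η)) ν := by
  have := J.separableSpace
  have := UniformSpace.secondCountable_of_separable K
  refine Integrable.of_bound
    (stronglyMeasurable_charFun.comp_measurable
      (J.continuous_truncate F).measurable).aestronglyMeasurable (μ.real Set.univ) ?_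
  exact .of_forall fun η => norm_charFun_le _

/-- The Parseval identity for the characteristic functions of two finite measures, truncated to a
finite-dimensional space of test vectors. -/
theorem integral_charFun_truncate_comm (μ ν : Measure K) [IsFiniteMeasure μ] [IsFiniteMeasure ν]
    (F : Finset K) :
    ∫ η, charFun μ (J.truncate F η) ∂ν = ∫ φ, charFun ν (J.truncate F φ) ∂μ := by
  have := J.separableSpace
  have := UniformSpace.secondCountable_of_separable K
  simp only [charFun_apply]
  rw [integral_integral_swap]
  · refine integral_congr_ae (.of_forall fun φ => ?_)
    refine integral_congr_ae (.of_forall fun η => ?_)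
    simp only
    -- Symmetry moves the truncation from one integration variable to the other.
    rw [real_inner_comm, J.inner_truncate_left, real_inner_comm]
  · have hc : Continuous fun p : K × K =>
        Complex.exp ((inner ℝ p.2 (J.truncate F p.1) : ℝ) * Complex.I) := by
      have := (J.continuous_truncate F).comp (continuous_fst (X := K) (Y := K))
      have h2 : Continuous fun p : K × K => (inner ℝ p.2 (J.truncate F p.1) : ℝ) :=
        continuous_snd.inner this
      fun_prop
    refine Integrable.of_bound hc.aestronglyMeasurable 1 (.of_forall fun p => ?_)
    rw [Function.uncurry, Complex.norm_exp_ofReal_mul_I]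

/-- Functions of the form `exp (-(c / 2) ‖·‖²)` on the test vectors extend to `K`, and the extension
is the limit along a fixed sequence of finite-dimensional spaces. -/
theorem tendsto_extend_of_eq_exp {c : ℝ} (hc : 0 ≤ c) {χ : K → ℂ}
    (hχ : ∀ y, χ y = Complex.exp (-(c / 2) * ‖J.test y‖ ^ 2 : ℝ))
    {s : ℕ → K} (hs : DenseRange s)
    {G : ℕ → Finset K} (hG : Monotone G) (hsG : ∀ m, ∃ n, s m ∈ G n) (η : K) :
    Tendsto (fun F : Finset K => χ (J.truncate F η)) atTop (𝓝 (J.extend χ η)) ∧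
      Tendsto (fun n => χ (J.truncate (G n) η)) atTop (𝓝 (J.extend χ η)) := by
  obtain ⟨L, h1, h2⟩ := J.exists_tendsto_exp_truncate hc hs hG hsG η
  have h1' : Tendsto (fun F : Finset K => χ (J.truncate F η)) atTop (𝓝 (L : ℂ)) := by
    simp only [hχ, ← Complex.ofReal_exp]
    exact (Complex.continuous_ofReal.tendsto L).comp h1
  have h2' : Tendsto (fun n => χ (J.truncate (G n) η)) atTop (𝓝 (L : ℂ)) := by
    simp only [hχ, ← Complex.ofReal_exp]
    exact (Complex.continuous_ofReal.tendsto L).comp h2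
  -- `extend` is a `limUnder`, meaningful only once convergence is known.
  have hL : J.extend χ η = L := h1'.limUnder_eq
  rw [hL]
  exact ⟨h1', h2'⟩

/-- The integral of the extension is the limit of the integrals of the truncations along a fixed
sequence of finite-dimensional spaces. -/
theorem integrable_extend_and_tendsto_integral {c : ℝ} (hc : 0 ≤ c) {χ : K → ℂ}
    (hχ : ∀ y, χ y = Complex.exp (-(c / 2) * ‖J.test y‖ ^ 2 : ℝ))
    {s : ℕ → K} (hs : DenseRange s)
    {G : ℕ → Finset K} (hG : Monotone G) (hsG : ∀ m, ∃ n, s m ∈ G n)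
    (ν : Measure K) [IsFiniteMeasure ν] :
    Integrable (J.extend χ) ν ∧
      Tendsto (fun n => ∫ η, χ (J.truncate (G n) η) ∂ν) atTop (𝓝 (∫ η, J.extend χ η ∂ν)) := by
  have := J.separableSpace
  have := UniformSpace.secondCountable_of_separable K
  have hcont : Continuous χ := by
    rw [funext hχ]
    fun_prop
  have hmeas : ∀ n, AEStronglyMeasurable (fun η => χ (J.truncate (G n) η)) ν := fun n =>
    (hcont.comp (J.continuous_truncate (G n))).aestronglyMeasurable
  have hle : ∀ y, ‖χ y‖ ≤ 1 := fun y => by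
    rw [hχ, ← Complex.ofReal_exp, Complex.norm_real, Real.norm_eq_abs, Real.abs_exp,
      Real.exp_le_one_iff, neg_mul, neg_nonpos]
    positivity
  -- Convergence along a sequence, not only along all finite sets, is what gives both measurability
  -- of the extension and dominated convergence.
  have hlim := fun η => (J.tendsto_extend_of_eq_exp hc hχ hs hG hsG η).2
  refine ⟨Integrable.of_bound (aestronglyMeasurable_of_tendsto_ae atTop hmeas
      (.of_forall hlim)) 1 (.of_forall fun η => ?_),
    tendsto_integral_of_dominated_convergence (fun _ => 1) hmeas (integrable_const 1)
      (fun n => .of_forall fun η => hle _) (.of_forall hlim)⟩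
  exact le_of_tendsto (hlim η).norm (.of_forall fun n => hle _)

end Parseval

/-! ### Compatibility with the projection -/

section Projection

variable {H K H' K' : Type*}
  [NormedAddCommGroup H] [InnerProductSpace ℝ H] [CompleteSpace H]
  [NormedAddCommGroup K] [InnerProductSpace ℝ K] [CompleteSpace K]
  [NormedAddCommGroup H'] [InnerProductSpace ℝ H'] [CompleteSpace H']
  [NormedAddCommGroup K'] [InnerProductSpace ℝ K'] [CompleteSpace K']
  (J : HilbertSchmidtExtension H K) (J' : HilbertSchmidtExtension H' K')

/-- The adjoint of the commuting square `Q ∘ J.incl = J'.incl ∘ P`. -/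
theorem test_adjoint {P : H →L[ℝ] H'} {Q : K →L[ℝ] K'}
    (hQ : ∀ ξ, Q (J.incl ξ) = J'.incl (P ξ)) (y : K') :
    J.test (ContinuousLinearMap.adjoint Q y) = ContinuousLinearMap.adjoint P (J'.test y) := by
  refine ext_inner_right ℝ fun ξ => ?_
  rw [J.inner_test, ContinuousLinearMap.adjoint_inner_left, hQ,
    ContinuousLinearMap.adjoint_inner_left, J'.inner_test]

end Projection

end HilbertSchmidtExtension

theorem charFun_map_continuousLinearMap {K K' : Type*}
    [NormedAddCommGroup K] [InnerProductSpace ℝ K] [CompleteSpace K]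
    [MeasurableSpace K] [BorelSpace K]
    [NormedAddCommGroup K'] [InnerProductSpace ℝ K'] [CompleteSpace K']
    [MeasurableSpace K'] [BorelSpace K'] [SecondCountableTopology K']
    (Q : K →L[ℝ] K') (μ : Measure K) (y : K') :
    charFun (μ.map Q) y = charFun μ (ContinuousLinearMap.adjoint Q y) := by
  rw [charFun_apply, charFun_apply, integral_map Q.continuous.measurable.aemeasurable
    (by fun_prop)]
  simp only [ContinuousLinearMap.adjoint_inner_right]

end TwistedForms

/-! ### The duality for the Gaussian measures on twisted forms -/

theorem mainTheorem1 {n : ℕ} {M : Type*} [TopologicalSpace M] [T2Space M] [CompactSpace M]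
    [PathConnectedSpace M] [ChartedSpace (EuclideanSpace ℝ (Fin n)) M] [IsManifold (𝓡 n) ∞ M]
    [RiemannianBundle (fun x : M => TangentSpace (𝓡 n) x)]
    [IsContMDiffRiemannianBundle (𝓡 n) ∞ (EuclideanSpace ℝ (Fin n))
      (fun x : M => TangentSpace (𝓡 n) x)]
    [MeasurableSpace M] [BorelSpace M]
    {V : Type*} [NormedAddCommGroup V] [InnerProductSpace ℝ V] {x₀ : M}
    (ρ : FundamentalGroup M x₀ →* (V ≃ₗᵢ[ℝ] V)) (hρ : TwistedForms.IsAcyclic n ρ)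
    (k : ℕ) (hk : k ≤ n) (a b : ℝ) (ha : 0 < a) (hb : 0 < b)
    {K : Type*} [NormedAddCommGroup K] [InnerProductSpace ℝ K] [CompleteSpace K]
    [MeasurableSpace K] [BorelSpace K]
    {K' : Type*} [NormedAddCommGroup K'] [InnerProductSpace ℝ K'] [CompleteSpace K']
    [MeasurableSpace K'] [BorelSpace K']
    (J : TwistedForms.HilbertSchmidtExtension (TwistedForms.L2Forms n ρ k) K)
    (J' : TwistedForms.HilbertSchmidtExtension (TwistedForms.L2Exact n ρ k) K')
    (Q : K →L[ℝ] K')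
    (hQ : ∀ ξ : TwistedForms.L2Forms n ρ k,
      Q (J.incl ξ) = J'.incl (TwistedForms.exactPart n ρ k ξ))
    (μ : Measure K) (hμ : J.IsGaussian a μ) (μ' : Measure K') (hμ' : J'.IsGaussian b μ') :
    let χ : K' → ℂ := fun y => charFun μ (ContinuousLinearMap.adjoint Q y)
    let χ' : K' → ℂ := fun y => charFun μ' y
    (∀ F : Finset K',
      Integrable (fun η => χ (J'.truncate F η)) μ' ∧
      Integrable (fun α => χ' (J'.truncate F (Q α))) μ ∧
      ∫ η, χ (J'.truncate F η) ∂μ' = ∫ α, χ' (J'.truncate F (Q α)) ∂μ) ∧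
    (∀ η : K', Tendsto (fun F : Finset K' => χ (J'.truncate F η)) atTop (𝓝 (J'.extend χ η))) ∧
    (∀ η : K', Tendsto (fun F : Finset K' => χ' (J'.truncate F η)) atTop (𝓝 (J'.extend χ' η))) ∧
    Integrable (fun η => J'.extend χ η) μ' ∧
    Integrable (fun α => J'.extend χ' (Q α)) μ ∧
    ∫ η, J'.extend χ η ∂μ' = ∫ α, J'.extend χ' (Q α) ∂μ := by
  intro χ χ'
  have := J'.separableSpace
  have := UniformSpace.secondCountable_of_separable K'
  have := hμ.isProbabilityMeasure
  have := hμ'.isProbabilityMeasure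
  have hQm : Measurable Q := Q.continuous.measurable
  have hχ : ∀ y, χ y = charFun (μ.map Q) y := fun y =>
    (TwistedForms.charFun_map_continuousLinearMap Q μ y).symm
  have hχ_exp : ∀ y, χ y = Complex.exp (-(a / 2) * ‖J'.test y‖ ^ 2 : ℝ) := fun y => by
    -- The adjoint of the orthogonal projection is the isometric inclusion, so the norm in `L2Forms`
    -- is the norm in `L2Exact`.
    have hP : ContinuousLinearMap.adjoint (TwistedForms.exactPart n ρ k) (J'.test y) =
        (J'.test y : TwistedForms.L2Forms n ρ k) := by
      rw [TwistedForms.exactPart, Submodule.adjoint_orthogonalProjectionOnto]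
      rfl
    rw [show χ y = _ from hμ.charFun_eq _, J.test_adjoint J' hQ, hP, Submodule.norm_coe]
  have hχ'_exp : ∀ y, χ' y = Complex.exp (-(b / 2) * ‖J'.test y‖ ^ 2 : ℝ) := hμ'.charFun_eq
  have hint : ∀ F, Integrable (fun η => χ (J'.truncate F η)) μ' := fun F => by
    simp only [hχ]
    exact J'.integrable_charFun_truncate _ _ F
  have hint' : ∀ F, Integrable (fun η => χ' (J'.truncate F η)) (μ.map Q) := fun F =>
    J'.integrable_charFun_truncate _ _ F
  have hcomm : ∀ F, ∫ η, χ (J'.truncate F η) ∂μ' =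
      ∫ η, χ' (J'.truncate F η) ∂(μ.map Q) := fun F => by
    simp only [hχ]
    exact J'.integral_charFun_truncate_comm _ _ F
  have hs := TopologicalSpace.denseRange_denseSeq K'
  classical
  -- One sequence of finite sets serves both `χ` and `χ'`, so the truncated identities can be
  -- compared term by term.
  let G : ℕ → Finset K' := fun m => (Finset.range m).image (TopologicalSpace.denseSeq K')
  have hG : Monotone G := fun m m' h => Finset.image_subset_image (Finset.range_mono h)
  have hsG : ∀ m, ∃ m', TopologicalSpace.denseSeq K' m ∈ G m' := fun m =>
    ⟨m + 1, Finset.mem_image_of_mem _ (Finset.self_mem_range_succ m)⟩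
  obtain ⟨h1, h2⟩ := J'.integrable_extend_and_tendsto_integral ha.le hχ_exp hs hG hsG μ'
  obtain ⟨h3, h4⟩ :=
    J'.integrable_extend_and_tendsto_integral hb.le hχ'_exp hs hG hsG (μ.map Q)
  refine ⟨fun F => ⟨hint F, (hint' F).comp_measurable hQm, ?_⟩,
    fun η => (J'.tendsto_extend_of_eq_exp ha.le hχ_exp hs hG hsG η).1,
    fun η => (J'.tendsto_extend_of_eq_exp hb.le hχ'_exp hs hG hsG η).1,
    h1, h3.comp_measurable hQm, ?_⟩
  · rw [hcomm, integral_map hQm.aemeasurable (hint' F).aestronglyMeasurable]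
  · simp only [hcomm] at h2
    -- By `hcomm` both integrals of the extensions are limits of the same sequence; the change of
    -- variables then returns from `μ.map Q` to `μ`.
    rw [tendsto_nhds_unique h2 h4, integral_map hQm.aemeasurable h3.aestronglyMeasurable]
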